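/- Let $k$ be an algebraically closed field, $V$ a finite-dimensional $k$-vector space, and $G = \mathrm{GL}(V)$. Let $V = U \oplus \tilde U$ be a decomposition into subspaces, and let $H = \mathrm{GL}(U) \subseteq G$, embedded by $g \mapsto g \oplus \mathrm{id}_{\tilde U}$. Let $K$ be a subgroup of $G$. Write $Y(H)$ for the set of cocharacters of $H$, i.e. homomorphisms of algebraic groups $\lambda : k^* \to H$. For $\lambda \in Y(H)$ put $$P_\lambda = \{g \in G : \lim_{a \to 0} \lambda(a) g \lambda(a)^{-1} \text{ exists in } G\}, \qquad L_\lambda = \{g \in G : \lim_{a \to 0} \lambda(a) g \lambda(a)^{-1} = g\},$$ where the limit of a morphism $\varphi : k^* \to G$ exists if $\varphi$ extends to a morphism $\hat\varphi : k \to G$, and is then $\hat\varphi(0)$. The subgroup $K$ is called *relatively $G$-completely reducible with respect to $H$* if for every $\lambda \in Y(H)$ with $K \subseteq P_\lambda$ there is $\mu \in Y(H)$ with $P_\lambda = P_\mu$ and $K \subseteq L_\mu$. A $K$-submodule of $V$ is a $K$-stable subspace, and a $K$-complement in $V$ to a $K$-submodule $W$ is a $K$-submodule $W'$ with $V = W \oplus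 W'$. Let $\sigma_K(U)$ be the $K$-submodule of $V$ generated by all $K$-submodules contained in $U$, and let $\iota_K(\tilde U)$ be the intersection of all $K$-submodules of $V$ that contain $\tilde U$. Then the following are equivalent: 1. $K$ is relatively $G$-completely reducible with respect to $H$; 2. every $K$-submodule of $V$ contained in $U$ has a $K$-complement in $V$ containing $\tilde U$, and every $K$-submodule of $V$ containing $\tilde U$ has a $K$-complement in $V$ contained in $U$; 3. $\sigma_K(U)$ is a completely reducible $K$-module, and $V = \sigma_K(U) \oplus \iota_K(\tilde U)$. -/

import Mathlib

namespace RelativeCR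

section AlgebraicGroup

variable {k V : Type*} [Field k] [AddCommGroup V] [Module k V]

/-- A map `φ : k^* → GL(V)` is a morphism of varieties: `φ(a)` is a Laurent polynomial in `a`
with finitely many coefficients in `End(V)`. (For a cocharacter, `φ(a)⁻¹ = φ(a⁻¹)`, so the
inverse determinant is then regular as well.) -/
def IsRegularOnUnits (φ : kˣ → LinearMap.GeneralLinearGroup k V) : Prop :=
  ∃ c : ℤ →₀ (V →ₗ[k] V), ∀ a : kˣ,
    (φ a : V →ₗ[k] V) = c.sum fun n A => ((a ^ n : kˣ) : k) • A

/-- A map `φ : k → GL(V)` is a morphism of varieties: `φ(a)` is a polynomial in `a` with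
coefficients in `End(V)`. (Since `φ` takes values in `GL(V)`, its determinant is a polynomial
without zeros, so over an algebraically closed field the inverse determinant is regular too.) -/
def IsRegularOnLine (φ : k → LinearMap.GeneralLinearGroup k V) : Prop :=
  ∃ c : ℕ →₀ (V →ₗ[k] V), ∀ a : k, (φ a : V →ₗ[k] V) = c.sum fun n A => a ^ n • A

/-- `lim_{a → 0} φ(a)` exists in `GL(V)` and equals `g`: the map `φ` on `k^*` extends to a
morphism `k → GL(V)` with value `g` at `0`. -/
def HasLimit (φ : kˣ → LinearMap.GeneralLinearGroup k V)
    (g : LinearMap.GeneralLinearGroup k V) : Prop :=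
  ∃ ψ : k → LinearMap.GeneralLinearGroup k V,
    IsRegularOnLine ψ ∧ (∀ a : kˣ, ψ (a : k) = φ a) ∧ ψ 0 = g

/-- `Y(H)`: the cocharacters of a subgroup `H` of `GL(V)`, that is, the homomorphisms of groups
`k^* → GL(V)` that are morphisms of varieties and take values in `H`. -/
def cocharacters (H : Subgroup (LinearMap.GeneralLinearGroup k V)) :
    Set (kˣ →* LinearMap.GeneralLinearGroup k V) :=
  {l | IsRegularOnUnits l ∧ ∀ a : kˣ, l a ∈ H}

/-- `P_λ`: the `g` in `GL(V)` such that `lim_{a → 0} λ(a) g λ(a)⁻¹` exists. -/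
def parabolic (l : kˣ →* LinearMap.GeneralLinearGroup k V) :
    Set (LinearMap.GeneralLinearGroup k V) :=
  {g | ∃ g', HasLimit (fun a => l a * g * (l a)⁻¹) g'}

/-- `L_λ`: the `g` in `GL(V)` such that `lim_{a → 0} λ(a) g λ(a)⁻¹ = g`. -/
def levi (l : kˣ →* LinearMap.GeneralLinearGroup k V) :
    Set (LinearMap.GeneralLinearGroup k V) :=
  {g | HasLimit (fun a => l a * g * (l a)⁻¹) g}

/-- `K` is relatively `GL(V)`-completely reducible with respect to `H`. -/
def IsRelativelyCR (K H : Subgroup (LinearMap.GeneralLinearGroup k V)) : Prop :=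
  ∀ l ∈ cocharacters H, (K : Set (LinearMap.GeneralLinearGroup k V)) ⊆ parabolic l →
    ∃ m ∈ cocharacters H, parabolic l = parabolic m ∧
      (K : Set (LinearMap.GeneralLinearGroup k V)) ⊆ levi m

/-- For `V = U ⊕ U'`, the map `End(U) → End(V)`, `f ↦ f ⊕ id`. -/
noncomputable def extendEnd {U U' : Submodule k V} (h : IsCompl U U') :
    Module.End k U →* Module.End k V where
  toFun f := LinearMap.ofIsCompl h (U.subtype ∘ₗ f) U'.subtype
  map_one' := LinearMap.ofIsCompl_eq h (fun _ => rfl) (fun _ => rfl)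
  map_mul' f g := LinearMap.ofIsCompl_eq h
    (fun u => by simp [Module.End.mul_apply, LinearMap.ofIsCompl_apply_left])
    (fun u => by simp [Module.End.mul_apply, LinearMap.ofIsCompl_apply_right])

/-- For `V = U ⊕ U'`, the subgroup `GL(U)` of `GL(V)`: the image of `g ↦ g ⊕ id`. -/
noncomputable def glSubgroup {U U' : Submodule k V} (h : IsCompl U U') :
    Subgroup (LinearMap.GeneralLinearGroup k V) :=
  MonoidHom.range (Units.map (extendEnd h))

end AlgebraicGroup

section Modules

variable {k V : Type*} [Field k] [AddCommGroup V] [Module k V]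

/-- The natural representation of a subgroup `K` of `GL(V)` on `V`. -/
def naturalRep (K : Subgroup (LinearMap.GeneralLinearGroup k V)) : Representation k K V :=
  (Units.coeHom (Module.End k V)).comp K.subtype

/-- The `K`-submodules of `V`. -/
abbrev KSubmodule (K : Subgroup (LinearMap.GeneralLinearGroup k V)) :=
  Subrepresentation (naturalRep K)

/-- `σ_K(W)`: the `K`-submodule generated by the `K`-submodules contained in `W`. -/
def sigma (K : Subgroup (LinearMap.GeneralLinearGroup k V)) (W : Submodule k V) :
    KSubmodule K where
  toSubmodule := sSup {X | ∃ M : KSubmodule K, M.toSubmodule = X ∧ X ≤ W}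
  apply_mem_toSubmodule g v hv := by
    have key : sSup {X | ∃ M : KSubmodule K, M.toSubmodule = X ∧ X ≤ W} ≤
        (sSup {X | ∃ M : KSubmodule K, M.toSubmodule = X ∧ X ≤ W}).comap
          (naturalRep K g) := by
      refine sSup_le ?_
      rintro X ⟨M, rfl, hM⟩ x hx
      have hle : M.toSubmodule ≤
          sSup {X | ∃ M : KSubmodule K, M.toSubmodule = X ∧ X ≤ W} :=
        le_sSup ⟨M, rfl, hM⟩
      exact hle (M.apply_mem_toSubmodule g hx)
    exact key hv

/-- `ι_K(W)`: the intersection of the `K`-submodules that contain `W`. -/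
def iota (K : Subgroup (LinearMap.GeneralLinearGroup k V)) (W : Submodule k V) :
    KSubmodule K where
  toSubmodule := sInf {X | ∃ M : KSubmodule K, M.toSubmodule = X ∧ W ≤ X}
  apply_mem_toSubmodule g v hv := by
    rw [Submodule.mem_sInf] at hv ⊢
    rintro X ⟨M, rfl, hM⟩
    exact M.apply_mem_toSubmodule g (hv _ ⟨M, rfl, hM⟩)

end Modules

end RelativeCR

namespace RelativeCR

section LaurentPolynomials

variable {k M : Type*} [Field k] [Infinite k] [AddCommGroup M] [Module k M]

theorem zpow_monoidHom_injective :
    Function.Injective fun n : ℤ => (Units.coeHom k).comp (zpowGroupHom n : kˣ →* kˣ) := by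
  have key : ∀ m : ℕ, (∀ a : kˣ, a ^ m = 1) → m = 0 := by
    intro m hm
    by_contra h0
    have : NeZero m := ⟨h0⟩
    have hfin : (Set.univ : Set kˣ).Finite := by
      have : (Set.univ : Set kˣ) ⊆ (rootsOfUnity m k : Set kˣ) :=
        fun a _ => hm a
      exact Set.Finite.subset
        (Set.finite_coe_iff.mp (inferInstanceAs (Finite (rootsOfUnity m k)))) this
    refine Set.infinite_univ (α := k) (((hfin.image Units.val).insert 0).subset fun x _ => ?_)
    by_cases hx : x = 0
    · exact Or.inl hx
    · exact Or.inr ⟨Units.mk0 x hx, trivial, rfl⟩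
  intro m n h
  have h1 : ∀ a : kˣ, a ^ m = a ^ n := fun a => Units.ext (DFunLike.congr_fun h a)
  have h2 : ∀ a : kˣ, a ^ (m - n) = 1 := fun a => by rw [zpow_sub, h1, mul_inv_cancel]
  have h3 : (m - n).natAbs = 0 := by
    refine key _ fun a => ?_
    rcases Int.natAbs_eq (m - n) with h | h
    · rw [← zpow_natCast, ← h, h2]
    · rw [← inv_eq_one, ← zpow_natCast, ← zpow_neg, ← h, h2]
  omega

theorem laurent_eq_zero (c : ℤ →₀ M)
    (h : ∀ a : kˣ, (c.sum fun n x => ((a ^ n : kˣ) : k) • x) = 0) : c = 0 := by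
  have hli := (linearIndependent_monoidHom kˣ k).comp _ (zpow_monoidHom_injective (k := k))
  ext n
  rw [Finsupp.zero_apply, ← Module.forall_dual_apply_eq_zero_iff k]
  intro f
  have := linearIndependent_iff.mp hli (c.mapRange f (map_zero f)) (by
    ext a
    have := congrArg f (h a)
    rw [Finsupp.linearCombination_apply, Finsupp.sum_mapRange_index (by simp), Finsupp.sum,
      Finset.sum_apply]
    rw [Finsupp.sum, map_sum, map_zero] at this
    rw [Pi.zero_apply, ← this]
    refine Finset.sum_congr rfl fun i _ => ?_
    simp [mul_comm])
  simpa using DFunLike.congr_fun this n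

theorem laurent_injective (c d : ℤ →₀ M)
    (h : ∀ a : kˣ, (c.sum fun n x => ((a ^ n : kˣ) : k) • x) =
      d.sum fun n x => ((a ^ n : kˣ) : k) • x) : c = d := by
  rw [← sub_eq_zero]
  refine laurent_eq_zero (k := k) _ fun a => ?_
  rw [Finsupp.sum_sub_index (fun n x y => smul_sub _ x y), h a, sub_self]

theorem eq_of_monomial_eq_polynomial (d : ℕ →₀ M) (x : M) (j : ℤ)
    (h : ∀ a : kˣ, ((a ^ j : kˣ) : k) • x = d.sum fun n y => (a : k) ^ n • y) :
    (j < 0 → x = 0) ∧ (j ≠ 0 → d 0 = 0) := by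
  have key : Finsupp.single j x = d.mapDomain (fun n : ℕ => (n : ℤ)) := by
    refine laurent_injective (k := k) _ _ fun a => ?_
    rw [Finsupp.sum_single_index (by simp), h a,
      Finsupp.sum_mapDomain_index (fun _ => smul_zero _) (fun _ _ _ => smul_add _ _ _)]
    simp
  constructor
  · intro hj
    have := DFunLike.congr_fun key j
    rw [Finsupp.single_eq_same, Finsupp.mapDomain_of_notMem_range] at this
    · exact this
    · rintro ⟨n, rfl⟩
      simp at hj
      omega
  · intro hj
    have := DFunLike.congr_fun key ((0 : ℕ) : ℤ)
    rw [Finsupp.mapDomain_apply Nat.cast_injective, Finsupp.single_apply, if_neg (by simpa using hj)]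
      at this
    exact this.symm

end LaurentPolynomials

section Gradings

variable {k V : Type*} [Field k] [AddCommGroup V] [Module k V]

/-- A finite family of orthogonal idempotents with sum `1`, indexed by weights. -/
structure IsGrading (c : ℤ →₀ Module.End k V) : Prop where
  mul_eq_zero : ∀ i j, i ≠ j → c i * c j = 0
  sum_eq_one : ∑ i ∈ c.support, c i = 1

/-- The coefficients `c` of `l` form a grading of `V` into weight spaces. -/
structure HasWeights (l : kˣ →* LinearMap.GeneralLinearGroup k V)
    (c : ℤ →₀ Module.End k V) : Prop where
  isGrading : IsGrading c
  coe_eq : ∀ a : kˣ, (l a : Module.End k V) = ∑ n ∈ c.support, ((a ^ n : kˣ) : k) • c n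

namespace IsGrading

variable {c : ℤ →₀ Module.End k V} (hc : IsGrading c)
include hc

theorem mul_self (i : ℤ) : c i * c i = c i := by
  by_cases hi : i ∈ c.support
  · conv_rhs => rw [← mul_one (c i), ← hc.sum_eq_one, Finset.mul_sum]
    exact (Finset.sum_eq_single_of_mem i hi fun j _ hj => hc.mul_eq_zero _ _ hj.symm).symm
  · rw [Finsupp.notMem_support_iff.mp hi, mul_zero]

theorem apply_self (i : ℤ) (v : V) : c i (c i v) = c i v := LinearMap.congr_fun (hc.mul_self i) v

theorem apply_of_ne {i j : ℤ} (h : i ≠ j) (v : V) : c i (c j v) = 0 :=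
  LinearMap.congr_fun (hc.mul_eq_zero i j h) v

theorem sum_apply (v : V) : ∑ i ∈ c.support, c i v = v := by
  simpa using LinearMap.congr_fun hc.sum_eq_one v

theorem sum_smul_mul (w : ℤ → k) (i : ℤ) : (∑ n ∈ c.support, w n • c n) * c i = w i • c i := by
  by_cases hi : i ∈ c.support
  · rw [Finset.sum_mul, Finset.sum_eq_single_of_mem i hi, smul_mul_assoc, hc.mul_self]
    intro j _ hj
    rw [smul_mul_assoc, hc.mul_eq_zero _ _ hj, smul_zero]
  · simp [Finsupp.notMem_support_iff.mp hi]

theorem mul_sum_smul (w : ℤ → k) (i : ℤ) : c i * (∑ n ∈ c.support, w n • c n) = w i • c i := by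
  by_cases hi : i ∈ c.support
  · rw [Finset.mul_sum, Finset.sum_eq_single_of_mem i hi, mul_smul_comm, hc.mul_self]
    intro j _ hj
    rw [mul_smul_comm, hc.mul_eq_zero _ _ hj.symm, smul_zero]
  · simp [Finsupp.notMem_support_iff.mp hi]

theorem eq_sum_sum (f : Module.End k V) :
    f = ∑ m ∈ c.support, ∑ n ∈ c.support, c m * f * c n := by
  conv_lhs => rw [← one_mul f, ← mul_one (1 * f), ← hc.sum_eq_one]
  simp_rw [Finset.sum_mul, Finset.mul_sum]

end IsGrading

theorem HasWeights.coe_mul {l : kˣ →* LinearMap.GeneralLinearGroup k V}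
    {c : ℤ →₀ Module.End k V} (h : HasWeights l c) (a : kˣ) (i : ℤ) :
    (l a : Module.End k V) * c i = ((a ^ i : kˣ) : k) • c i := by
  rw [h.coe_eq, h.isGrading.sum_smul_mul fun n => ((a ^ n : kˣ) : k)]

theorem HasWeights.mul_coe {l : kˣ →* LinearMap.GeneralLinearGroup k V}
    {c : ℤ →₀ Module.End k V} (h : HasWeights l c) (a : kˣ) (i : ℤ) :
    c i * (l a : Module.End k V) = ((a ^ i : kˣ) : k) • c i := by
  rw [h.coe_eq, h.isGrading.mul_sum_smul fun n => ((a ^ n : kˣ) : k)]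

theorem HasWeights.isRegularOnUnits {l : kˣ →* LinearMap.GeneralLinearGroup k V}
    {c : ℤ →₀ Module.End k V} (h : HasWeights l c) : IsRegularOnUnits l :=
  ⟨c, h.coe_eq⟩

theorem IsRegularOnUnits.exists_hasWeights [Infinite k]
    {l : kˣ →* LinearMap.GeneralLinearGroup k V} (hl : IsRegularOnUnits l) :
    ∃ c, HasWeights l c := by
  obtain ⟨c, hc⟩ := hl
  have h1 : ∀ (b : kˣ) (m : ℤ), ((b ^ m : kˣ) : k) • c m = c m * (l b : Module.End k V) := by
    intro b m
    have : c.mapRange (fun x => x * (l b : Module.End k V)) (zero_mul _) =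
        Finsupp.onFinset c.support (fun m => ((b ^ m : kˣ) : k) • c m)
          (fun m hm => by
            rw [Finsupp.mem_support_iff]; rintro h; simp [h] at hm) := by
      refine laurent_injective (k := k) _ _ fun a => ?_
      rw [Finsupp.sum_mapRange_index (by simp),
        Finsupp.onFinset_sum _ (fun _ => smul_zero _)]
      have h2 : (l (a * b) : Module.End k V) = (l a : Module.End k V) * (l b : Module.End k V) := by
        rw [map_mul, Units.val_mul]
      rw [hc (a * b), hc a, Finsupp.sum, Finsupp.sum, Finset.sum_mul] at h2
      simp only [Finsupp.sum, smul_mul_assoc] at h2 ⊢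
      rw [← h2]
      refine Finset.sum_congr rfl fun i _ => ?_
      rw [mul_zpow, Units.val_mul, smul_smul]
    simpa using (DFunLike.congr_fun this m).symm
  have h3 : ∀ m, Finsupp.single m (c m) = c.mapRange (fun x => c m * x) (mul_zero _) := by
    intro m
    refine laurent_injective (k := k) _ _ fun b => ?_
    rw [Finsupp.sum_single_index (by simp), Finsupp.sum_mapRange_index (by simp), h1, hc b,
      Finsupp.sum, Finsupp.sum, Finset.mul_sum]
    simp
  refine ⟨c, ⟨fun i j hij => ?_, ?_⟩, hc⟩
  · have := DFunLike.congr_fun (h3 i) j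
    rw [Finsupp.single_eq_of_ne hij.symm, Finsupp.mapRange_apply] at this
    exact this.symm
  · have := hc 1
    simpa [Finsupp.sum] using this.symm

/-- A grading of `V` defines a cocharacter. -/
noncomputable def IsGrading.cocharacter {c : ℤ →₀ Module.End k V} (hc : IsGrading c) :
    kˣ →* LinearMap.GeneralLinearGroup k V :=
  MonoidHom.toHomUnits
    { toFun := fun a => ∑ n ∈ c.support, ((a ^ n : kˣ) : k) • c n
      map_one' := by simpa using hc.sum_eq_one
      map_mul' := fun a b => by
        rw [Finset.mul_sum]
        refine Finset.sum_congr rfl fun i _ => ?_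
        rw [mul_smul_comm, hc.sum_smul_mul fun n => ((a ^ n : kˣ) : k), smul_smul, mul_zpow,
          Units.val_mul, mul_comm] }

theorem IsGrading.hasWeights_cocharacter {c : ℤ →₀ Module.End k V} (hc : IsGrading c) :
    HasWeights hc.cocharacter c :=
  ⟨hc, fun _ => rfl⟩

/-- The endomorphisms that do not lower weights. -/
def parabolicAlgebra (c : ℤ →₀ Module.End k V) : Set (Module.End k V) :=
  {f | ∀ m n, m < n → c m * f * c n = 0}

/-- The sum of the weight spaces of weight at least `n`. -/
def filtration (c : ℤ →₀ Module.End k V) (n : ℤ) : Submodule k V :=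
  ⨅ i : Set.Iio n, LinearMap.ker (c i)

theorem mem_filtration {c : ℤ →₀ Module.End k V} {n : ℤ} {v : V} :
    v ∈ filtration c n ↔ ∀ i < n, c i v = 0 := by
  simp [filtration, Submodule.mem_iInf]

theorem filtration_antitone (c : ℤ →₀ Module.End k V) : Antitone (filtration c) :=
  fun _ _ h _ hv => mem_filtration.mpr fun i hi => mem_filtration.mp hv i (hi.trans_le h)

namespace IsGrading

variable {c : ℤ →₀ Module.End k V} (hc : IsGrading c)
include hc

theorem apply_mem_filtration (n : ℤ) (v : V) : c n v ∈ filtration c n :=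
  mem_filtration.mpr fun _ hi => hc.apply_of_ne hi.ne v

theorem mem_parabolicAlgebra_iff {f : Module.End k V} :
    f ∈ parabolicAlgebra c ↔ ∀ n, filtration c n ≤ (filtration c n).comap f := by
  constructor
  · intro hf n v hv
    refine mem_filtration.mpr fun i hi => ?_
    rw [← hc.sum_apply v, map_sum, map_sum]
    refine Finset.sum_eq_zero fun j _ => ?_
    rcases lt_or_ge j n with hj | hj
    · rw [mem_filtration.mp hv j hj, map_zero, map_zero]
    · exact LinearMap.congr_fun (hf i j (hi.trans_le hj)) v
  · intro hf m n hmn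
    ext v
    exact mem_filtration.mp (hf n (hc.apply_mem_filtration n v)) m hmn

theorem coe_inv_mem_parabolicAlgebra [FiniteDimensional k V]
    {g : LinearMap.GeneralLinearGroup k V} (hg : (g : Module.End k V) ∈ parabolicAlgebra c) :
    ((g⁻¹ : LinearMap.GeneralLinearGroup k V) : Module.End k V) ∈ parabolicAlgebra c := by
  rw [hc.mem_parabolicAlgebra_iff] at hg ⊢
  intro n v hv
  have hinj : Function.Injective (g : Module.End k V) :=
    (LinearMap.GeneralLinearGroup.toLinearEquiv g).injective
  have hmap : (filtration c n).map (g : Module.End k V) = filtration c n := by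
    refine Submodule.eq_of_le_of_finrank_eq (Submodule.map_le_iff_le_comap.mpr (hg n)) ?_
    exact LinearEquiv.finrank_map_eq (LinearMap.GeneralLinearGroup.toLinearEquiv g) _
  rw [← hmap] at hv
  obtain ⟨w, hw, rfl⟩ := hv
  have : ((g⁻¹ : LinearMap.GeneralLinearGroup k V) : Module.End k V) ((g : Module.End k V) w) = w :=
    LinearMap.congr_fun (Units.inv_mul g) w
  rw [Submodule.mem_comap, this]
  exact hw

theorem diagonal_mul {f g : Module.End k V} (hf : f ∈ parabolicAlgebra c)
    (hg : g ∈ parabolicAlgebra c) :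
    (∑ n ∈ c.support, c n * f * c n) * (∑ n ∈ c.support, c n * g * c n) =
      ∑ n ∈ c.support, c n * (f * g) * c n := by
  rw [Finset.sum_mul]
  refine Finset.sum_congr rfl fun n hn => ?_
  rw [Finset.mul_sum, Finset.sum_eq_single_of_mem n hn]
  · have h : f * g = ∑ i ∈ c.support, f * c i * g := by
      rw [← Finset.sum_mul, ← Finset.mul_sum, hc.sum_eq_one, mul_one]
    rw [h, Finset.mul_sum, Finset.sum_mul, Finset.sum_eq_single_of_mem n hn]
    · simp only [mul_assoc]
      rw [← mul_assoc (c n) (c n), hc.mul_self]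
    · intro i _ hi
      rcases lt_or_gt_of_ne hi with h | h
      · rw [show c n * (f * c i * g) * c n = c n * f * (c i * g * c n) by simp only [mul_assoc],
          hg i n h, mul_zero]
      · rw [show c n * (f * c i * g) * c n = (c n * f * c i) * g * c n by simp only [mul_assoc],
          hf n i h, zero_mul, zero_mul]
  · intro j _ hj
    rw [show c n * f * c n * (c j * g * c j) = c n * f * (c n * c j) * (g * c j) by
      simp only [mul_assoc], hc.mul_eq_zero _ _ hj.symm, mul_zero, zero_mul]

theorem diagonal_one : ∑ n ∈ c.support, c n * 1 * c n = 1 := by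
  simp only [mul_one, hc.mul_self, hc.sum_eq_one]

end IsGrading

theorem exists_polynomial_sum {ι : Type*} (s : Finset ι) (φ : ι → k → Module.End k V)
    (h : ∀ i ∈ s, ∃ d : ℕ →₀ Module.End k V, ∀ a, φ i a = d.sum fun n A => a ^ n • A) :
    ∃ d : ℕ →₀ Module.End k V, ∀ a, ∑ i ∈ s, φ i a = d.sum fun n A => a ^ n • A := by
  classical
  induction s using Finset.induction_on with
  | empty => exact ⟨0, by simp⟩
  | insert i s hi ih =>
    obtain ⟨d, hd⟩ := ih fun j hj => h j (Finset.mem_insert_of_mem hj)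
    obtain ⟨e, he⟩ := h i (Finset.mem_insert_self _ _)
    refine ⟨e + d, fun a => ?_⟩
    rw [Finset.sum_insert hi, hd, he,
      Finsupp.sum_add_index' (fun _ => smul_zero _) (fun _ _ _ => smul_add _ _ _)]

namespace HasWeights

variable {l : kˣ →* LinearMap.GeneralLinearGroup k V} {c : ℤ →₀ Module.End k V}
  (h : HasWeights l c)
include h

theorem inv_mul_coe (a : kˣ) (i : ℤ) :
    (((l a)⁻¹ : LinearMap.GeneralLinearGroup k V) : Module.End k V) * c i =
      ((a ^ (-i) : kˣ) : k) • c i := by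
  rw [← map_inv, h.coe_mul, inv_zpow, zpow_neg]

theorem block_conj (g : LinearMap.GeneralLinearGroup k V) (a : kˣ) (m n : ℤ) :
    c m * ((l a * g * (l a)⁻¹ : LinearMap.GeneralLinearGroup k V) : Module.End k V) * c n =
      ((a ^ (m - n) : kˣ) : k) • (c m * (g : Module.End k V) * c n) := by
  rw [Units.val_mul, Units.val_mul, mul_assoc, mul_assoc, mul_assoc, h.inv_mul_coe, ← mul_assoc,
    h.mul_coe, mul_smul_comm, smul_mul_assoc, mul_smul_comm, smul_smul, sub_eq_add_neg, zpow_add,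
    Units.val_mul, mul_comm (_ : k), mul_assoc]

theorem block_eq_zero_of_hasLimit [Infinite k] {g g' : LinearMap.GeneralLinearGroup k V}
    (hg : HasLimit (fun a => l a * g * (l a)⁻¹) g') (m n : ℤ) :
    (m < n → c m * (g : Module.End k V) * c n = 0) ∧
      (m ≠ n → c m * (g' : Module.End k V) * c n = 0) := by
  obtain ⟨ψ, ⟨d, hd⟩, hψ, rfl⟩ := hg
  have hd' : ∀ a, c m * (ψ a : Module.End k V) * c n =
      (d.mapRange (fun A => c m * A * c n) (by simp)).sum fun i A => a ^ i • A := by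
    intro a
    rw [Finsupp.sum_mapRange_index (fun _ => smul_zero _), hd a, Finsupp.sum, Finsupp.sum,
      Finset.mul_sum, Finset.sum_mul]
    simp
  have key := eq_of_monomial_eq_polynomial (k := k)
    (d.mapRange (fun A => c m * A * c n) (by simp)) (c m * (g : Module.End k V) * c n) (m - n)
    (fun a => by rw [← hd' a, hψ, h.block_conj])
  refine ⟨fun hmn => key.1 (by omega), fun hmn => ?_⟩
  have h0 := key.2 (by omega)
  rw [Finsupp.mapRange_apply] at h0
  have : (ψ 0 : Module.End k V) = d 0 := by
    rw [hd 0, Finsupp.sum, Finset.sum_eq_single 0]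
    · simp
    · intro b _ hb
      simp [hb]
    · intro hb
      simp [Finsupp.notMem_support_iff.mp hb]
  rw [this, h0]

theorem mem_parabolic_iff [Infinite k] [FiniteDimensional k V]
    {g : LinearMap.GeneralLinearGroup k V} :
    g ∈ parabolic l ↔ (g : Module.End k V) ∈ parabolicAlgebra c := by
  have hc := h.isGrading
  refine ⟨fun ⟨g', hg⟩ m n hmn => (h.block_eq_zero_of_hasLimit hg m n).1 hmn, fun hg => ?_⟩
  have hg' := hc.coe_inv_mem_parabolicAlgebra hg
  let g₀ : LinearMap.GeneralLinearGroup k V :=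
    ⟨∑ n ∈ c.support, c n * g * c n,
      ∑ n ∈ c.support, c n * ((g⁻¹ : LinearMap.GeneralLinearGroup k V) : Module.End k V) * c n,
      by rw [hc.diagonal_mul hg hg', Units.mul_inv, hc.diagonal_one],
      by rw [hc.diagonal_mul hg' hg, Units.inv_mul, hc.diagonal_one]⟩
  classical
  let ψ : k → LinearMap.GeneralLinearGroup k V := fun a =>
    if ha : a = 0 then g₀ else l (Units.mk0 a ha) * g * (l (Units.mk0 a ha))⁻¹
  refine ⟨g₀, ψ, ?_, ?_, by simp [ψ]⟩
  · have hpoly := exists_polynomial_sum (k := k) c.support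
      (fun m a => ∑ n ∈ c.support,
        if n ≤ m then a ^ (m - n).toNat • (c m * (g : Module.End k V) * c n) else 0)
      (fun m _ => exists_polynomial_sum _ _ fun n _ => by
        split_ifs
        · exact ⟨Finsupp.single (m - n).toNat _, fun a => by
            rw [Finsupp.sum_single_index (by simp)]⟩
        · exact ⟨0, by simp⟩)
    obtain ⟨d, hd⟩ := hpoly
    refine ⟨d, fun a => ?_⟩
    rw [← hd]
    by_cases ha : a = 0
    · subst ha
      simp only [ψ, dite_true, g₀]
      refine Finset.sum_congr rfl fun m hm => ?_
      rw [Finset.sum_eq_single_of_mem m hm]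
      · simp
      · intro n _ hn
        split_ifs with hle
        · rw [zero_pow (by omega), zero_smul]
        · rfl
    · simp only [ψ, dif_neg ha]
      rw [hc.eq_sum_sum ((_ : LinearMap.GeneralLinearGroup k V) : Module.End k V)]
      refine Finset.sum_congr rfl fun m _ => Finset.sum_congr rfl fun n _ => ?_
      rw [h.block_conj]
      split_ifs with hle
      · lift m - n to ℕ using by omega with j
        simp
      · rw [hg m n (by omega), smul_zero]
  · intro a
    simp [ψ]

theorem mem_levi_iff [Infinite k] {g : LinearMap.GeneralLinearGroup k V} :
    g ∈ levi l ↔ ∀ m n, m ≠ n → c m * (g : Module.End k V) * c n = 0 := by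
  refine ⟨fun hg m n hmn => (h.block_eq_zero_of_hasLimit hg m n).2 hmn, fun hg => ?_⟩
  refine ⟨fun _ => g, ⟨Finsupp.single 0 (g : Module.End k V), fun a => ?_⟩, fun a => ?_, rfl⟩
  · rw [Finsupp.sum_single_index (by simp), pow_zero, one_smul]
  · refine Units.ext ?_
    rw [h.isGrading.eq_sum_sum ((l a * g * (l a)⁻¹ : LinearMap.GeneralLinearGroup k V) : Module.End k V)]
    conv_lhs => rw [h.isGrading.eq_sum_sum (g : Module.End k V)]
    refine Finset.sum_congr rfl fun m _ => Finset.sum_congr rfl fun n _ => ?_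
    rw [h.block_conj]
    by_cases hmn : m = n
    · simp [hmn]
    · rw [hg m n hmn, smul_zero]

end HasWeights

end Gradings

end RelativeCR
namespace RelativeCR

section Cocharacters

variable {k V : Type*} [Field k] [AddCommGroup V] [Module k V]

theorem mem_glSubgroup_iff {U U' : Submodule k V} (hU : IsCompl U U')
    {g : LinearMap.GeneralLinearGroup k V} :
    g ∈ glSubgroup hU ↔
      (∀ u ∈ U', (g : Module.End k V) u = u) ∧ ∀ v, (g : Module.End k V) v - v ∈ U := by
  constructor
  · rintro ⟨f, rfl⟩
    have hl : ∀ u : U, ((Units.map (extendEnd hU) f : LinearMap.GeneralLinearGroup k V) :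
        Module.End k V) u = (f : Module.End k U) u := fun u =>
      LinearMap.ofIsCompl_apply_left hU u
    have hr : ∀ u ∈ U', ((Units.map (extendEnd hU) f : LinearMap.GeneralLinearGroup k V) :
        Module.End k V) u = u := fun u hu => LinearMap.ofIsCompl_apply_right hU ⟨u, hu⟩
    refine ⟨hr, fun v => ?_⟩
    obtain ⟨u, hu, w, hw, rfl⟩ := Submodule.mem_sup.mp (hU.sup_eq_top ▸ Submodule.mem_top (x := v))
    rw [map_add, hr w hw, hl ⟨u, hu⟩, add_sub_add_right_eq_sub]
    exact U.sub_mem (Submodule.coe_mem _) hu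
  · rintro ⟨hr, hl⟩
    have hmap : ∀ u ∈ U, (g : Module.End k V) u ∈ U := fun u hu => by
      simpa using U.add_mem (hl u) hu
    have hinv : ∀ v, (g : Module.End k V)
        (((g⁻¹ : LinearMap.GeneralLinearGroup k V) : Module.End k V) v) = v :=
      fun v => LinearMap.congr_fun (Units.mul_inv g) v
    have hinv' : ∀ v, ((g⁻¹ : LinearMap.GeneralLinearGroup k V) : Module.End k V)
        ((g : Module.End k V) v) = v :=
      fun v => LinearMap.congr_fun (Units.inv_mul g) v
    have hmap' : ∀ u ∈ U, ((g⁻¹ : LinearMap.GeneralLinearGroup k V) : Module.End k V) u ∈ U :=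
      fun u hu => by
        have := U.sub_mem hu (hl (((g⁻¹ : LinearMap.GeneralLinearGroup k V) : Module.End k V) u))
        rwa [hinv, sub_sub_cancel] at this
    refine ⟨⟨(g : Module.End k V).restrict hmap,
      ((g⁻¹ : LinearMap.GeneralLinearGroup k V) : Module.End k V).restrict hmap',
      LinearMap.ext fun u => Subtype.ext (hinv u), LinearMap.ext fun u => Subtype.ext (hinv' u)⟩, ?_⟩
    refine Units.ext (LinearMap.ofIsCompl_eq hU (fun u => rfl) fun u => (hr u u.2).symm)

theorem HasWeights.mem_cocharacters_iff [Infinite k] {U U' : Submodule k V} (hU : IsCompl U U')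
    {l : kˣ →* LinearMap.GeneralLinearGroup k V} {c : ℤ →₀ Module.End k V} (h : HasWeights l c) :
    l ∈ cocharacters (glSubgroup hU) ↔ ∀ n ≠ 0, (∀ u ∈ U', c n u = 0) ∧ ∀ v, c n v ∈ U := by
  have happ : ∀ a v, (l a : Module.End k V) v =
      ∑ n ∈ c.support, ((a ^ n : kˣ) : k) • c n v := fun a v => by
    rw [h.coe_eq, LinearMap.sum_apply]
    rfl
  constructor
  · rintro ⟨-, hl⟩ n hn
    refine ⟨fun u hu => ?_, fun v => ?_⟩
    · have : c.mapRange (fun A => A u) rfl = Finsupp.single 0 u := by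
        refine laurent_injective (k := k) _ _ fun a => ?_
        rw [Finsupp.sum_mapRange_index (by simp), Finsupp.sum_single_index (by simp), zpow_zero,
          Units.val_one, one_smul]
        exact (happ a u).symm.trans (((mem_glSubgroup_iff hU).mp (hl a)).1 u hu)
      simpa [hn.symm] using DFunLike.congr_fun this n
    · have : c.mapRange (fun A => U.mkQ (A v))
          (by rw [LinearMap.zero_apply, map_zero]) = Finsupp.single 0 (U.mkQ v) := by
        refine laurent_injective (k := k) _ _ fun a => ?_
        rw [Finsupp.sum_mapRange_index (by simp), Finsupp.sum_single_index (by simp), zpow_zero,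
          Units.val_one, one_smul]
        have h1 := ((mem_glSubgroup_iff hU).mp (hl a)).2 v
        rw [← Submodule.Quotient.eq, happ] at h1
        rw [Submodule.mkQ_apply, ← h1, ← Submodule.mkQ_apply, map_sum]
        simp [Finsupp.sum]
      have := DFunLike.congr_fun this n
      rw [Finsupp.single_eq_of_ne hn, Finsupp.mapRange_apply] at this
      exact (Submodule.Quotient.mk_eq_zero U).mp this
  · intro hc
    refine ⟨h.isRegularOnUnits, fun a => (mem_glSubgroup_iff hU).mpr ?_⟩
    have hsub : ∀ v, (l a : Module.End k V) v - v =
        ∑ n ∈ c.support, (((a ^ n : kˣ) : k) - 1) • c n v := fun v => by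
      conv_lhs => rw [happ, ← h.isGrading.sum_apply v]
      simp only [h.isGrading.sum_apply v, sub_smul, one_smul, Finset.sum_sub_distrib]
    refine ⟨fun u hu => ?_, fun v => ?_⟩
    · rw [← sub_eq_zero, hsub]
      refine Finset.sum_eq_zero fun n _ => ?_
      by_cases hn : n = 0
      · simp [hn]
      · rw [(hc n hn).1 u hu, smul_zero]
    · rw [hsub]
      refine U.sum_mem fun n _ => ?_
      by_cases hn : n = 0
      · simp [hn]
      · exact U.smul_mem _ ((hc n hn).2 v)

theorem HasWeights.parabolicAlgebra_subset [Infinite k] [FiniteDimensional k V]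
    {l m : kˣ →* LinearMap.GeneralLinearGroup k V} {c d : ℤ →₀ Module.End k V}
    (hl : HasWeights l c) (hm : HasWeights m d) (h : parabolic m ⊆ parabolic l) :
    parabolicAlgebra d ⊆ parabolicAlgebra c := by
  intro f hf
  obtain ⟨s, hs⟩ := (Module.End.finite_spectrum f).exists_notMem
  rw [spectrum.notMem_iff] at hs
  obtain ⟨u, hu⟩ := hs
  have hone : ∀ {e : ℤ →₀ Module.End k V}, IsGrading e → ∀ i j, i < j →
      e i * algebraMap k (Module.End k V) s * e j = 0 := fun he i j hij => by
    rw [Algebra.algebraMap_eq_smul_one, mul_smul_comm, mul_one, smul_mul_assoc,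
      he.mul_eq_zero _ _ hij.ne, smul_zero]
  have hud : u ∈ parabolic m := hm.mem_parabolic_iff.mpr fun i j hij => by
    rw [hu, mul_sub, sub_mul, hone hm.isGrading i j hij, hf i j hij, sub_zero]
  intro i j hij
  have h1 := hl.mem_parabolic_iff.mp (h hud) i j hij
  rwa [hu, mul_sub, sub_mul, hone hl.isGrading i j hij, zero_sub, neg_eq_zero] at h1

end Cocharacters

section Filtrations

variable {k V : Type*} [Field k] [AddCommGroup V] [Module k V]

namespace IsGrading

variable {c : ℤ →₀ Module.End k V} (hc : IsGrading c)
include hc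

theorem exists_filtration_eq_bot : ∃ n, filtration c n = ⊥ := by
  obtain ⟨n, hn⟩ := c.support.bddAbove
  refine ⟨n + 1, (Submodule.eq_bot_iff _).mpr fun v hv => ?_⟩
  rw [← hc.sum_apply v]
  exact Finset.sum_eq_zero fun i hi => mem_filtration.mp hv i (Int.lt_add_one_of_le (hn hi))

theorem sub_apply_mem_filtration {n : ℤ} {v : V} (hv : v ∈ filtration c n) :
    v - c n v ∈ filtration c (n + 1) := by
  refine mem_filtration.mpr fun i hi => ?_
  rcases (Int.lt_add_one_iff.mp hi).lt_or_eq with h | rfl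
  · rw [map_sub, mem_filtration.mp hv i h, hc.apply_of_ne h.ne, sub_zero]
  · rw [map_sub, hc.apply_self, sub_self]

/-- A subspace stable under the endomorphisms that do not lower weights is a step of the
filtration. -/
theorem exists_eq_filtration {W : Submodule k V}
    (hW : parabolicAlgebra c ⊆ {f | W ≤ W.comap f}) : ∃ n, W = filtration c n := by
  classical
  by_cases hS : (c.support.filter fun n => ∃ w ∈ W, c n w ≠ 0).Nonempty
  · obtain ⟨m, hm, hmin⟩ := Finset.exists_min_image _ id hS
    obtain ⟨w, hw, hw0⟩ := (Finset.mem_filter.mp hm).2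
    refine ⟨m, le_antisymm (fun x hx => mem_filtration.mpr fun i hi => ?_) fun v hv => ?_⟩
    · by_contra h
      refine hi.not_ge (hmin i (Finset.mem_filter.mpr ⟨?_, x, hx, h⟩))
      exact Finsupp.mem_support_iff.mpr fun h0 => h (by rw [h0, LinearMap.zero_apply])
    · rw [← hc.sum_apply v]
      refine W.sum_mem fun n _ => ?_
      rcases lt_or_ge n m with hn | hn
      · rw [mem_filtration.mp hv n hn]
        exact W.zero_mem
      obtain ⟨φ, hφ⟩ : ∃ φ : Module.Dual k V, φ (c m w) ≠ 0 := by
        by_contra! h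
        exact hw0 ((Module.forall_dual_apply_eq_zero_iff k _).mp h)
      have hf : (LinearMap.toSpanSingleton k V (c n v)) ∘ₗ φ ∘ₗ c m ∈ parabolicAlgebra c := by
        intro i j hij
        ext x
        simp only [Module.End.mul_apply, LinearMap.comp_apply, LinearMap.toSpanSingleton_apply,
          map_smul, LinearMap.zero_apply]
        rcases eq_or_ne i n with rfl | hi
        · rw [hc.apply_of_ne (by omega), map_zero, zero_smul]
        · rw [hc.apply_of_ne hi, smul_zero]
      exact (W.smul_mem_iff hφ).mp (hW hf hw)
  · obtain ⟨n, hn⟩ := hc.exists_filtration_eq_bot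
    refine ⟨n, hn ▸ (Submodule.eq_bot_iff _).mpr fun w hw => ?_⟩
    rw [← hc.sum_apply w]
    refine Finset.sum_eq_zero fun i hi => ?_
    by_contra h
    exact hS ⟨i, Finset.mem_filter.mpr ⟨hi, w, hw, h⟩⟩

end IsGrading

theorem exists_filtration_eq_top (c : ℤ →₀ Module.End k V) :
    ∃ n, filtration c n = ⊤ := by
  obtain ⟨n, hn⟩ := c.support.bddBelow
  refine ⟨n, (Submodule.eq_top_iff').mpr fun v => mem_filtration.mpr fun i hi => ?_⟩
  rw [Finsupp.notMem_support_iff.mp fun h => hi.not_ge (hn h), LinearMap.zero_apply]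

/-- The sum of the weight spaces of weight less than `n`. -/
def cofiltration (c : ℤ →₀ Module.End k V) (n : ℤ) : Submodule k V :=
  ⨅ i : Set.Ici n, LinearMap.ker (c i)

theorem mem_cofiltration {c : ℤ →₀ Module.End k V} {n : ℤ} {v : V} :
    v ∈ cofiltration c n ↔ ∀ i, n ≤ i → c i v = 0 := by
  simp [cofiltration, Submodule.mem_iInf]

theorem IsGrading.isCompl_filtration {c : ℤ →₀ Module.End k V} (hc : IsGrading c) (n : ℤ) :
    IsCompl (filtration c n) (cofiltration c n) := by
  classical
  refine ⟨Submodule.disjoint_def.mpr fun v hv hv' => ?_, codisjoint_iff.mpr ?_⟩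
  · rw [← hc.sum_apply v]
    refine Finset.sum_eq_zero fun i _ => ?_
    rcases lt_or_ge i n with h | h
    · exact mem_filtration.mp hv i h
    · exact mem_cofiltration.mp hv' i h
  · refine Submodule.eq_top_iff'.mpr fun v => ?_
    rw [← hc.sum_apply v]
    refine Submodule.sum_mem _ fun i _ => ?_
    rcases lt_or_ge i n with h | h
    · exact Submodule.mem_sup_right
        (mem_cofiltration.mpr fun j hj => hc.apply_of_ne (by omega) v)
    · exact Submodule.mem_sup_left (filtration_antitone c h (hc.apply_mem_filtration i v))

theorem IsGrading.apply_mem_cofiltration {c : ℤ →₀ Module.End k V} (hc : IsGrading c)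
    {f : Module.End k V} (hf : ∀ m n, m ≠ n → c m * f * c n = 0) {n : ℤ} {v : V}
    (hv : v ∈ cofiltration c n) : f v ∈ cofiltration c n := by
  refine mem_cofiltration.mpr fun i hi => ?_
  rw [← hc.sum_apply v, map_sum, map_sum]
  refine Finset.sum_eq_zero fun j _ => ?_
  rcases eq_or_ne i j with rfl | hj
  · rw [mem_cofiltration.mp hv i hi, map_zero, map_zero]
  · exact LinearMap.congr_fun (hf i j hj) v

end Filtrations

section TwoStep

variable {k V : Type*} [Field k] [AddCommGroup V] [Module k V]

open Classical in
/-- The weights `j` on the image and `0` on the kernel of an idempotent. -/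
noncomputable def twoStep (j : ℤ) (e : Module.End k V) : ℤ →₀ Module.End k V :=
  Finsupp.onFinset {0, j} (fun i => if i = 0 then 1 - e else if i = j then e else 0)
    fun i hi => by
      by_contra h
      simp only [Finset.mem_insert, Finset.mem_singleton, not_or] at h
      simp [h.1, h.2] at hi

variable {j : ℤ} {e : Module.End k V}

theorem twoStep_zero : twoStep j e 0 = 1 - e := by simp [twoStep]

theorem twoStep_self (hj : j ≠ 0) : twoStep j e j = e := by simp [twoStep, hj]

theorem twoStep_of_ne {i : ℤ} (h0 : i ≠ 0) (hj : i ≠ j) : twoStep j e i = 0 := by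
  simp [twoStep, h0, hj]

theorem isGrading_twoStep (hj : j ≠ 0) (he : e * e = e) : IsGrading (twoStep j e) where
  mul_eq_zero m n hmn := by
    by_cases hm0 : m = 0
    · subst hm0
      by_cases hnj : n = j
      · subst hnj
        rw [twoStep_zero, twoStep_self hj, sub_mul, one_mul, he, sub_self]
      · rw [twoStep_of_ne hmn.symm hnj, mul_zero]
    · by_cases hmj : m = j
      · subst hmj
        by_cases hn0 : n = 0
        · subst hn0
          rw [twoStep_zero, twoStep_self hj, mul_sub, mul_one, he, sub_self]
        · rw [twoStep_of_ne hn0 hmn.symm, mul_zero]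
      · rw [twoStep_of_ne hm0 hmj, zero_mul]
  sum_eq_one := by
    classical
    rw [Finset.sum_subset (s₁ := (twoStep j e).support) (s₂ := {0, j})
      Finsupp.support_onFinset_subset
      fun i _ hi => Finsupp.notMem_support_iff.mp hi, Finset.sum_pair hj.symm, twoStep_zero,
      twoStep_self hj, sub_add_cancel]

theorem parabolicAlgebra_twoStep_one (he : e * e = e) :
    parabolicAlgebra (twoStep 1 e) = {f | LinearMap.range e ≤ (LinearMap.range e).comap f} := by
  have hfix : ∀ x, x ∈ LinearMap.range e ↔ (1 - e : Module.End k V) x = 0 := fun x => by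
    rw [LinearMap.sub_apply, Module.End.one_apply, sub_eq_zero]
    refine ⟨?_, fun h => ⟨x, h.symm⟩⟩
    rintro ⟨y, rfl⟩
    exact (LinearMap.congr_fun he y).symm
  ext f
  constructor
  · rintro hf _ ⟨y, rfl⟩
    have := hf 0 1 one_pos
    rw [twoStep_zero, twoStep_self one_ne_zero] at this
    exact (hfix _).mpr (LinearMap.congr_fun this y)
  · intro hf m n hmn
    by_cases h : m = 0 ∧ n = 1
    · obtain ⟨rfl, rfl⟩ := h
      rw [twoStep_zero, twoStep_self one_ne_zero]
      ext y
      exact (hfix _).mp (hf ⟨y, rfl⟩)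
    · by_cases hm : m = 0 ∨ m = 1
      · rw [twoStep_of_ne (i := n) (by omega) (by omega), mul_zero]
      · rw [twoStep_of_ne (i := m) (by omega) (by omega), zero_mul, zero_mul]

theorem parabolicAlgebra_twoStep_neg_one (he : e * e = e) :
    parabolicAlgebra (twoStep (-1) e) = {f | LinearMap.ker e ≤ (LinearMap.ker e).comap f} := by
  ext f
  constructor
  · intro hf x hx
    have := hf (-1) 0 (by omega)
    rw [twoStep_zero, twoStep_self (by omega)] at this
    have := LinearMap.congr_fun this x
    simpa [LinearMap.mem_ker.mp hx] using this
  · intro hf m n hmn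
    by_cases h : m = -1 ∧ n = 0
    · obtain ⟨rfl, rfl⟩ := h
      rw [twoStep_zero, twoStep_self (by omega)]
      ext y
      refine LinearMap.mem_ker.mp (hf (x := (1 - e : Module.End k V) y) ?_)
      rw [LinearMap.mem_ker, ← Module.End.mul_apply, mul_sub, mul_one, he, sub_self,
        LinearMap.zero_apply]
    · by_cases hm : m = 0 ∨ m = -1
      · rw [twoStep_of_ne (i := n) (by omega) (by omega), mul_zero]
      · rw [twoStep_of_ne (i := m) (by omega) (by omega), zero_mul, zero_mul]

end TwoStep

end RelativeCR
namespace RelativeCR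

section Regrading

variable {k V : Type*} [Field k] [AddCommGroup V] [Module k V]

/-- The conjugate of a family of endomorphisms by an automorphism of `V`. -/
noncomputable def conjGrading (T : (Module.End k V)ˣ) (c : ℤ →₀ Module.End k V) : ℤ →₀ Module.End k V :=
  c.mapRange (fun A => T * A * (T⁻¹ : (Module.End k V)ˣ)) (by simp)

variable {c : ℤ →₀ Module.End k V}

theorem conjGrading_apply (T : (Module.End k V)ˣ) (n : ℤ) :
    conjGrading T c n = T * c n * (T⁻¹ : (Module.End k V)ˣ) := rfl

theorem IsGrading.conj (hc : IsGrading c) (T : (Module.End k V)ˣ) :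
    IsGrading (conjGrading T c) where
  mul_eq_zero i j hij := by
    rw [conjGrading_apply, conjGrading_apply]
    calc _ = T * (c i * ((T⁻¹ : (Module.End k V)ˣ) * T) * c j) * (T⁻¹ : (Module.End k V)ˣ) := by
          simp only [mul_assoc]
      _ = 0 := by rw [Units.inv_mul, mul_one, hc.mul_eq_zero i j hij, mul_zero, zero_mul]
  sum_eq_one := by
    change (conjGrading T c).sum (fun _ A => A) = 1
    rw [conjGrading, Finsupp.sum_mapRange_index fun _ => rfl, Finsupp.sum, ← Finset.sum_mul,
      ← Finset.mul_sum, hc.sum_eq_one, mul_one, Units.mul_inv]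

theorem IsGrading.mul_mem_parabolicAlgebra (hc : IsGrading c) {f g : Module.End k V}
    (hf : f ∈ parabolicAlgebra c) (hg : g ∈ parabolicAlgebra c) : f * g ∈ parabolicAlgebra c := by
  rw [hc.mem_parabolicAlgebra_iff] at hf hg ⊢
  exact fun n v hv => hf n (hg n hv)

theorem IsGrading.parabolicAlgebra_conj [FiniteDimensional k V] (hc : IsGrading c)
    {T : (Module.End k V)ˣ} (hT : (T : Module.End k V) ∈ parabolicAlgebra c) :
    parabolicAlgebra (conjGrading T c) = parabolicAlgebra c := by
  have hT' : ((T⁻¹ : (Module.End k V)ˣ) : Module.End k V) ∈ parabolicAlgebra c :=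
    hc.coe_inv_mem_parabolicAlgebra hT
  have key : ∀ f : Module.End k V, f ∈ parabolicAlgebra (conjGrading T c) ↔
      (T⁻¹ : (Module.End k V)ˣ) * f * T ∈ parabolicAlgebra c := fun f => by
    refine forall₃_congr fun m n _ => ?_
    rw [conjGrading_apply, conjGrading_apply,
      show T * c m * (T⁻¹ : (Module.End k V)ˣ) * f * (T * c n * (T⁻¹ : (Module.End k V)ˣ)) =
        T * (c m * ((T⁻¹ : (Module.End k V)ˣ) * f * T) * c n) * (T⁻¹ : (Module.End k V)ˣ) by
        simp only [mul_assoc], Units.mul_left_eq_zero, Units.mul_right_eq_zero]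
  ext f
  rw [key]
  refine ⟨fun h => ?_, fun h => hc.mul_mem_parabolicAlgebra (hc.mul_mem_parabolicAlgebra hT' h) hT⟩
  have := hc.mul_mem_parabolicAlgebra (hc.mul_mem_parabolicAlgebra hT h) hT'
  simpa [← mul_assoc] using this

/-- If `f - 1` raises the filtration, then `f` is invertible. -/
theorem IsGrading.isUnit_of_sub_mem [FiniteDimensional k V] (hc : IsGrading c)
    {f : Module.End k V} (hf : ∀ n, ∀ v ∈ filtration c n, f v - v ∈ filtration c (n + 1)) :
    IsUnit f := by
  rw [LinearMap.isUnit_iff_ker_eq_bot, Submodule.eq_bot_iff]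
  intro v hv
  obtain ⟨a, ha⟩ := exists_filtration_eq_top c
  obtain ⟨b, hb⟩ := hc.exists_filtration_eq_bot
  have key : ∀ n, a ≤ n → v ∈ filtration c n := fun n hn => by
    induction n, hn using Int.leInduction with
    | base => rw [ha]; trivial
    | succ n _ ih =>
      have := hf n v ih
      rw [LinearMap.mem_ker.mp hv, zero_sub, Submodule.neg_mem_iff] at this
      exact this
  have := filtration_antitone c (le_max_right a b) (key _ (le_max_left a b))
  rwa [hb, Submodule.mem_bot] at this

/-- Complements of the steps of the filtration of a grading are the weight spaces of another
grading with the same parabolic algebra. -/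
theorem IsGrading.exists_grading_of_complements [FiniteDimensional k V] (hc : IsGrading c)
    (D : ℤ → Submodule k V) (hdisj : ∀ n, Disjoint (D n) (filtration c (n + 1)))
    (hsup : ∀ n, D n ⊔ filtration c (n + 1) = filtration c n) :
    ∃ d, IsGrading d ∧ parabolicAlgebra d = parabolicAlgebra c ∧ (∀ n v, d n v ∈ D n) ∧
      ∀ n, ∀ v ∈ D n, d n v = v := by
  choose X hDX hX using fun n => (hdisj n).exists_isCompl
  let π : ℤ → Module.End k V := fun n => (X n).projection _ (hX n)
  have hπ0 : ∀ n, ∀ v ∈ filtration c (n + 1), π n v = 0 := fun n v hv =>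
    (Submodule.projection_apply_eq_zero_iff (hX n)).mpr hv
  have hπD : ∀ n, ∀ v ∈ D n, π n v = v := fun n v hv =>
    Submodule.projection_apply_of_mem_left (hX n) (hDX n hv)
  have hπ : ∀ n, ∀ v ∈ filtration c n, π n v ∈ D n ∧ π n v - v ∈ filtration c (n + 1) := by
    intro n v hv
    rw [← hsup n] at hv
    obtain ⟨x, hx, y, hy, rfl⟩ := Submodule.mem_sup.mp hv
    rw [map_add, hπD n x hx, hπ0 n y hy, add_zero, sub_add_cancel_left]
    exact ⟨hx, Submodule.neg_mem _ hy⟩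
  let f : Module.End k V := ∑ n ∈ c.support, π n * c n
  have hfc : ∀ n v, f (c n v) = π n (c n v) := fun n v => by
    simp only [f, LinearMap.sum_apply, Module.End.mul_apply]
    by_cases hn : n ∈ c.support
    · rw [Finset.sum_eq_single_of_mem n hn, hc.apply_self]
      intro i _ hi
      rw [hc.apply_of_ne hi, map_zero]
    · simp [Finsupp.notMem_support_iff.mp hn]
  have hf : ∀ n, ∀ v ∈ filtration c n, f v - v ∈ filtration c (n + 1) := fun n v hv => by
    have : f v - v = ∑ i ∈ c.support, (f (c i v) - c i v) := by
      rw [Finset.sum_sub_distrib, ← map_sum, hc.sum_apply]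
    rw [this]
    refine Submodule.sum_mem _ fun i _ => ?_
    rcases lt_or_ge i n with hi | hi
    · rw [mem_filtration.mp hv i hi, map_zero, sub_zero]
      exact Submodule.zero_mem _
    · rw [hfc]
      exact filtration_antitone c (by omega) (hπ i _ (hc.apply_mem_filtration i v)).2
  obtain ⟨T, hT⟩ := hc.isUnit_of_sub_mem hf
  have hTp : (T : Module.End k V) ∈ parabolicAlgebra c := by
    rw [hT, hc.mem_parabolicAlgebra_iff]
    intro n v hv
    have := (filtration c n).add_mem (filtration_antitone c (by omega) (hf n v hv)) hv
    rwa [sub_add_cancel] at this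
  refine ⟨conjGrading T c, hc.conj T, hc.parabolicAlgebra_conj hTp, fun n v => ?_,
    fun n v hv => ?_⟩
  · rw [conjGrading_apply, Module.End.mul_apply, Module.End.mul_apply, hT, hfc]
    exact (hπ n _ (hc.apply_mem_filtration n _)).1
  · have hvn : v ∈ filtration c n := hsup n ▸ Submodule.mem_sup_left hv
    have h1 : v = (T : Module.End k V) (c n v) := by
      have := hπ0 n _ (hc.sub_apply_mem_filtration hvn)
      rw [map_sub, sub_eq_zero, hπD n v hv] at this
      rw [hT, hfc, ← this]
    conv_lhs => rw [h1]
    rw [conjGrading_apply, Module.End.mul_apply, Module.End.mul_apply,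
      ← Module.End.mul_apply _ (T : Module.End k V), Units.inv_mul, Module.End.one_apply,
      hc.apply_self, ← h1]

end Regrading

section Complements

variable {k V : Type*} [Field k] [AddCommGroup V] [Module k V]
  {K : Subgroup (LinearMap.GeneralLinearGroup k V)}

theorem sigma_toSubmodule_le (K : Subgroup (LinearMap.GeneralLinearGroup k V))
    (U : Submodule k V) : (sigma K U).toSubmodule ≤ U := by
  refine sSup_le ?_
  rintro X ⟨_, _, h⟩
  exact h

theorem le_sigma_toSubmodule {U : Submodule k V} (W : KSubmodule K) (h : W.toSubmodule ≤ U) :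
    W.toSubmodule ≤ (sigma K U).toSubmodule :=
  le_sSup ⟨W, rfl, h⟩

theorem le_iota_toSubmodule (K : Subgroup (LinearMap.GeneralLinearGroup k V))
    (U : Submodule k V) : U ≤ (iota K U).toSubmodule := by
  refine le_sInf ?_
  rintro X ⟨_, _, h⟩
  exact h

theorem iota_toSubmodule_le {U : Submodule k V} (W : KSubmodule K) (h : U ≤ W.toSubmodule) :
    (iota K U).toSubmodule ≤ W.toSubmodule :=
  sInf_le ⟨W, rfl, h⟩

theorem isSemisimpleRepresentation_iff_exists_complement (Y : KSubmodule K) :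
    Y.toRepresentation.IsSemisimpleRepresentation ↔ ∀ X : KSubmodule K,
      X.toSubmodule ≤ Y.toSubmodule → ∃ C : KSubmodule K,
        Disjoint C.toSubmodule X.toSubmodule ∧ C.toSubmodule ⊔ X.toSubmodule = Y.toSubmodule := by
  constructor
  · intro h X hX
    let X' : Subrepresentation Y.toRepresentation :=
      ⟨X.toSubmodule.comap Y.toSubmodule.subtype, fun g v hv => X.apply_mem_toSubmodule g hv⟩
    obtain ⟨C', hC'⟩ := h.exists_isCompl X'
    let C : KSubmodule K := ⟨C'.toSubmodule.map Y.toSubmodule.subtype, by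
      rintro g _ ⟨v, hv, rfl⟩
      exact ⟨_, C'.apply_mem_toSubmodule g hv, rfl⟩⟩
    have hX' : X'.toSubmodule.map Y.toSubmodule.subtype = X.toSubmodule := by
      rw [Submodule.map_comap_subtype, inf_eq_right.mpr hX]
    refine ⟨C, ?_, ?_⟩
    · rw [disjoint_iff, ← hX']
      change C'.toSubmodule.map Y.toSubmodule.subtype ⊓ _ = _
      rw [← Submodule.map_inf _ Y.toSubmodule.injective_subtype, inf_comm,
        show X'.toSubmodule ⊓ C'.toSubmodule = ⊥ from
          congrArg Subrepresentation.toSubmodule hC'.inf_eq_bot, Submodule.map_bot]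
    · rw [← hX']
      change C'.toSubmodule.map Y.toSubmodule.subtype ⊔ _ = _
      rw [← Submodule.map_sup, sup_comm,
        show X'.toSubmodule ⊔ C'.toSubmodule = ⊤ from
          congrArg Subrepresentation.toSubmodule hC'.sup_eq_top, Submodule.map_subtype_top]
  · intro h
    refine ⟨fun X' => ?_⟩
    let X : KSubmodule K := ⟨X'.toSubmodule.map Y.toSubmodule.subtype, by
      rintro g _ ⟨v, hv, rfl⟩
      exact ⟨_, X'.apply_mem_toSubmodule g hv, rfl⟩⟩
    obtain ⟨C, hdisj, hsup⟩ := h X (Submodule.map_subtype_le _ _)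
    let C' : Subrepresentation Y.toRepresentation :=
      ⟨C.toSubmodule.comap Y.toSubmodule.subtype, fun g v hv => C.apply_mem_toSubmodule g hv⟩
    have hC' : C'.toSubmodule.map Y.toSubmodule.subtype = C.toSubmodule := by
      rw [Submodule.map_comap_subtype, inf_eq_right.mpr (hsup ▸ le_sup_left)]
    have hinj := Submodule.map_injective_of_injective Y.toSubmodule.injective_subtype
    refine ⟨C', isCompl_iff.mpr ⟨disjoint_iff.mpr ?_, codisjoint_iff.mpr ?_⟩⟩
    · refine Subrepresentation.toSubmodule_injective (hinj ?_)
      change (X'.toSubmodule ⊓ C'.toSubmodule).map _ = (⊥ : Submodule k Y.toSubmodule).map _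
      rw [Submodule.map_inf _ Y.toSubmodule.injective_subtype, hC', Submodule.map_bot, inf_comm]
      exact hdisj.eq_bot
    · refine Subrepresentation.toSubmodule_injective (hinj ?_)
      change (X'.toSubmodule ⊔ C'.toSubmodule).map _ = (⊤ : Submodule k Y.toSubmodule).map _
      rw [Submodule.map_sup, hC', Submodule.map_subtype_top, sup_comm]
      exact hsup

theorem exists_relative_complement {Y : KSubmodule K}
    (h : Y.toRepresentation.IsSemisimpleRepresentation) (X Z : KSubmodule K)
    (hXZ : X.toSubmodule ≤ Z.toSubmodule) (hZY : Z.toSubmodule ≤ Y.toSubmodule) :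
    ∃ S : KSubmodule K, Disjoint S.toSubmodule X.toSubmodule ∧
      S.toSubmodule ⊔ X.toSubmodule = Z.toSubmodule := by
  obtain ⟨C, hdisj, hsup⟩ :=
    (isSemisimpleRepresentation_iff_exists_complement Y).mp h X (hXZ.trans hZY)
  refine ⟨C ⊓ Z, hdisj.mono_left inf_le_left, ?_⟩
  rw [Subrepresentation.toSubmodule_inf, inf_comm, inf_sup_assoc_of_le _ hXZ, hsup,
    inf_eq_left.mpr hZY]

end Complements

section Equivalences

variable {k V : Type*} [Field k] [AddCommGroup V] [Module k V]
  {K : Subgroup (LinearMap.GeneralLinearGroup k V)} {U U' : Submodule k V}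

/-- The step of the filtration of a grading as a `K`-submodule. -/
def filtrationKSubmodule {c : ℤ →₀ Module.End k V} (hc : IsGrading c)
    (hK : ∀ g ∈ K, (g : Module.End k V) ∈ parabolicAlgebra c) (n : ℤ) : KSubmodule K where
  toSubmodule := filtration c n
  apply_mem_toSubmodule g _ hv := hc.mem_parabolicAlgebra_iff.mp (hK g g.2) n hv

theorem isRelativelyCR_of_isCompl [Infinite k] [FiniteDimensional k V] (hU : IsCompl U U')
    (hss : (sigma K U).toRepresentation.IsSemisimpleRepresentation)
    (hcompl : IsCompl (sigma K U).toSubmodule (iota K U').toSubmodule) :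
    IsRelativelyCR K (glSubgroup hU) := by
  intro l hl hKl
  obtain ⟨c, hlc⟩ := hl.1.exists_hasWeights
  have hc := hlc.isGrading
  have hcU := (hlc.mem_cocharacters_iff hU).mp hl
  set σ := sigma K U
  set ι := iota K U'
  let F : ℤ → KSubmodule K :=
    filtrationKSubmodule hc fun g hg => hlc.mem_parabolic_iff.mp (hKl hg)
  have hFanti : ∀ n, (F (n + 1)).toSubmodule ≤ (F n).toSubmodule := fun n =>
    filtration_antitone c (by omega)
  have hFpos : ∀ n, 0 < n → (F n).toSubmodule ≤ σ.toSubmodule := fun n hn =>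
    le_sigma_toSubmodule _ fun v hv => by
      rw [← hc.sum_apply v]
      refine U.sum_mem fun i _ => ?_
      by_cases hi : i = 0
      · rw [mem_filtration.mp hv i (by omega)]
        exact U.zero_mem
      · exact (hcU i hi).2 v
  have hFneg : ∀ n, n ≤ 0 → ι.toSubmodule ≤ (F n).toSubmodule := fun n hn =>
    iota_toSubmodule_le _ fun v hv => mem_filtration.mpr fun i hi => (hcU i (by omega)).1 v hv
  have hFneg' : ∀ n, n ≤ 0 → (F n ⊓ σ).toSubmodule ⊔ ι.toSubmodule = (F n).toSubmodule :=
    fun n hn => by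
      rw [Subrepresentation.toSubmodule_inf, inf_sup_assoc_of_le _ (hFneg n hn),
        hcompl.sup_eq_top, inf_top_eq]
  have hFpos' : ∀ n, 0 < n → (F n ⊓ σ).toSubmodule = (F n).toSubmodule := fun n hn =>
    inf_eq_left.mpr (hFpos n hn)
  choose S hSdisj hSsup using fun n => exists_relative_complement hss (F (n + 1) ⊓ σ) (F n ⊓ σ)
    (inf_le_inf_right _ (hFanti n)) inf_le_right
  have hSσ : ∀ n, (S n).toSubmodule ≤ σ.toSubmodule := fun n =>
    le_sup_left.trans ((hSsup n).le.trans inf_le_right)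
  have hsupdisj : ∀ n, Disjoint ((S n).toSubmodule ⊔ (F (n + 1) ⊓ σ).toSubmodule)
      ι.toSubmodule := fun n => hcompl.disjoint.mono_left ((hSsup n).le.trans inf_le_right)
  let D : ℤ → KSubmodule K := fun n => if n = 0 then S 0 ⊔ ι else S n
  have hD0 : D 0 = S 0 ⊔ ι := if_pos rfl
  have hDne : ∀ n, n ≠ 0 → D n = S n := fun n hn => if_neg hn
  have hdisj : ∀ n, Disjoint (D n).toSubmodule (filtration c (n + 1)) := fun n => by
    change Disjoint (D n).toSubmodule (F (n + 1)).toSubmodule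
    rcases lt_trichotomy n 0 with hn | rfl | hn
    · rw [hDne n hn.ne, ← hFneg' (n + 1) (by omega)]
      exact (hSdisj n).disjoint_sup_right_of_disjoint_sup_left (hsupdisj n)
    · rw [hD0, ← hFpos' (0 + 1) (by omega), Subrepresentation.toSubmodule_sup]
      refine ((hSdisj 0).symm.disjoint_sup_right_of_disjoint_sup_left ?_).symm
      rw [sup_comm]
      exact hsupdisj 0
    · rw [hDne n hn.ne', ← hFpos' (n + 1) (by omega)]
      exact hSdisj n
  have hsup : ∀ n, (D n).toSubmodule ⊔ filtration c (n + 1) = filtration c n := fun n => by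
    change (D n).toSubmodule ⊔ (F (n + 1)).toSubmodule = (F n).toSubmodule
    rcases lt_trichotomy n 0 with hn | rfl | hn
    · rw [hDne n hn.ne, ← hFneg' (n + 1) (by omega), ← sup_assoc, hSsup, hFneg' n hn.le]
    · rw [hD0, ← hFpos' (0 + 1) (by omega), Subrepresentation.toSubmodule_sup, sup_right_comm,
        hSsup, hFneg' 0 le_rfl]
    · rw [hDne n hn.ne', ← hFpos' (n + 1) (by omega), hSsup, hFpos' n hn]
  obtain ⟨d, hd, hdc, hdD, hdfix⟩ :=
    hc.exists_grading_of_complements (fun n => (D n).toSubmodule) hdisj hsup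
  have hdzero : ∀ m n, m ≠ n → ∀ v ∈ (D n).toSubmodule, d m v = 0 := fun m n hmn v hv => by
    rw [← hdfix n v hv, hd.apply_of_ne hmn]
  have hm := hd.hasWeights_cocharacter
  refine ⟨hd.cocharacter, (hm.mem_cocharacters_iff hU).mpr fun n hn => ⟨fun u hu => ?_, fun v => ?_⟩,
    Set.ext fun g => by rw [hlc.mem_parabolic_iff, hm.mem_parabolic_iff, hdc], fun g hg => ?_⟩
  · refine hdzero n 0 hn u ?_
    rw [hD0]
    exact Submodule.mem_sup_right (le_iota_toSubmodule K U' hu)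
  · have := hdD n v
    simp only [hDne n hn] at this
    exact sigma_toSubmodule_le K U (hSσ n this)
  · refine hm.mem_levi_iff.mpr fun m n hmn => LinearMap.ext fun v => ?_
    exact hdzero m n hmn _ ((D n).apply_mem_toSubmodule ⟨g, hg⟩ (hdD n v))

/-- If `K` is relatively completely reducible and `W` is a `K`-submodule whose stabilizer is the
parabolic subgroup of a cocharacter, then `W` is a step of the filtration of a cocharacter that is
centralized by `K`. -/
theorem IsRelativelyCR.exists_grading [Infinite k] [FiniteDimensional k V] (hU : IsCompl U U')
    (hK : IsRelativelyCR K (glSubgroup hU)) (W : KSubmodule K) {c : ℤ →₀ Module.End k V}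
    (hc : IsGrading c) (hcU : ∀ n ≠ 0, (∀ u ∈ U', c n u = 0) ∧ ∀ v, c n v ∈ U)
    (hW : parabolicAlgebra c = {f | W.toSubmodule ≤ W.toSubmodule.comap f}) :
    ∃ d, IsGrading d ∧ (∀ n ≠ 0, (∀ u ∈ U', d n u = 0) ∧ ∀ v, d n v ∈ U) ∧
      ∃ n, W.toSubmodule = filtration d n ∧
        ∃ C : KSubmodule K, C.toSubmodule = cofiltration d n := by
  have hl := hc.hasWeights_cocharacter
  obtain ⟨m, hmH, hpar, hlevi⟩ := hK hc.cocharacter ((hl.mem_cocharacters_iff hU).mpr hcU)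
    fun g hg => hl.mem_parabolic_iff.mpr (hW ▸ fun v hv => W.apply_mem_toSubmodule ⟨g, hg⟩ hv)
  obtain ⟨d, hm⟩ := hmH.1.exists_hasWeights
  have hd := hm.isGrading
  obtain ⟨n, hn⟩ := hd.exists_eq_filtration (W := W.toSubmodule)
    (hW ▸ hl.parabolicAlgebra_subset hm hpar.ge)
  exact ⟨d, hd, (hm.mem_cocharacters_iff hU).mp hmH, n, hn, ⟨cofiltration d n, fun g v hv =>
    hd.apply_mem_cofiltration (hm.mem_levi_iff.mp (hlevi g.2)) hv⟩, rfl⟩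

theorem IsRelativelyCR.exists_complement_of_le [Infinite k] [FiniteDimensional k V]
    (hU : IsCompl U U') (hK : IsRelativelyCR K (glSubgroup hU)) (W : KSubmodule K)
    (hWU : W.toSubmodule ≤ U) :
    ∃ W' : KSubmodule K, IsCompl W.toSubmodule W'.toSubmodule ∧ U' ≤ W'.toSubmodule := by
  obtain ⟨D, hD, hWD⟩ := (hU.disjoint.symm.mono_right hWU).exists_isCompl
  let e : Module.End k V := W.toSubmodule.projection D hWD.symm
  have he : e * e = e := Submodule.isIdempotentElem_projection hWD.symm
  have hrange : LinearMap.range e = W.toSubmodule := Submodule.range_projection hWD.symm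
  obtain ⟨d, hd, hdU, n, hn, C, hC⟩ := hK.exists_grading hU W
    (isGrading_twoStep one_ne_zero he) (fun i hi => by
      by_cases h1 : i = 1
      · rw [h1, twoStep_self one_ne_zero]
        exact ⟨fun u hu => (Submodule.projection_apply_eq_zero_iff hWD.symm).mpr (hD hu),
          fun v => hWU (hrange ▸ ⟨v, rfl⟩)⟩
      · rw [twoStep_of_ne hi h1]
        exact ⟨fun _ _ => rfl, fun _ => U.zero_mem⟩)
    (by rw [parabolicAlgebra_twoStep_one he, hrange])
  refine ⟨C, by rw [hn, hC]; exact hd.isCompl_filtration n, fun u hu => ?_⟩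
  rw [hC, mem_cofiltration]
  intro i hi
  by_cases hi0 : i = 0
  · have hu0 : d 0 u = u := by
      conv_rhs => rw [← hd.sum_apply u]
      symm
      refine Finset.sum_eq_single 0 (fun j _ hj => (hdU j hj).1 u hu) fun h => ?_
      rw [Finsupp.notMem_support_iff.mp h, LinearMap.zero_apply]
    have huW : u ∈ W.toSubmodule := by
      rw [hn, ← hu0, ← hi0]
      exact filtration_antitone d hi (hd.apply_mem_filtration i u)
    rw [Submodule.disjoint_def.mp hU.disjoint u (hWU huW) hu, map_zero]
  · exact (hdU i hi0).1 u hu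

theorem IsRelativelyCR.exists_complement_of_ge [Infinite k] [FiniteDimensional k V]
    (hU : IsCompl U U') (hK : IsRelativelyCR K (glSubgroup hU)) (W : KSubmodule K)
    (hWU : U' ≤ W.toSubmodule) :
    ∃ W' : KSubmodule K, IsCompl W.toSubmodule W'.toSubmodule ∧ W'.toSubmodule ≤ U := by
  obtain ⟨D, hD, hWD⟩ := (hU.codisjoint.mono_right hWU).exists_isCompl
  let e : Module.End k V := D.projection W.toSubmodule hWD
  have he : e * e = e := Submodule.isIdempotentElem_projection hWD
  have hker : LinearMap.ker e = W.toSubmodule := Submodule.ker_projection hWD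
  obtain ⟨d, hd, hdU, n, hn, C, hC⟩ := hK.exists_grading hU W
    (isGrading_twoStep (j := -1) (by omega) he) (fun i hi => by
      by_cases h1 : i = -1
      · rw [h1, twoStep_self (by omega)]
        exact ⟨fun u hu => (Submodule.projection_apply_eq_zero_iff hWD).mpr (hWU hu),
          fun v => hD (Submodule.projection_apply_mem hWD v)⟩
      · rw [twoStep_of_ne hi h1]
        exact ⟨fun _ _ => rfl, fun _ => U.zero_mem⟩)
    (by rw [parabolicAlgebra_twoStep_neg_one he, hker])
  refine ⟨C, by rw [hn, hC]; exact hd.isCompl_filtration n, ?_⟩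
  have hU0 : ∀ v, d 0 v = 0 → v ∈ U := fun v hv => by
    rw [← hd.sum_apply v]
    refine U.sum_mem fun i _ => ?_
    by_cases hi : i = 0
    · rw [hi, hv]
      exact U.zero_mem
    · exact (hdU i hi).2 v
  rw [hC]
  intro v hv
  rcases le_or_gt n 0 with h | h
  · exact hU0 v (mem_cofiltration.mp hv 0 h)
  · have hle : U' ≤ U := hWU.trans fun w hw => hU0 w (mem_filtration.mp (hn ▸ hw) 0 h)
    have : U = ⊤ := by rw [← hU.sup_eq_top, sup_eq_left.mpr hle]
    rw [this]
    trivial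

theorem isSemisimple_and_isCompl_of_complements
    (h₁ : ∀ W : KSubmodule K, W.toSubmodule ≤ U →
      ∃ W' : KSubmodule K, IsCompl W.toSubmodule W'.toSubmodule ∧ U' ≤ W'.toSubmodule)
    (h₂ : ∀ W : KSubmodule K, U' ≤ W.toSubmodule →
      ∃ W' : KSubmodule K, IsCompl W.toSubmodule W'.toSubmodule ∧ W'.toSubmodule ≤ U) :
    (sigma K U).toRepresentation.IsSemisimpleRepresentation ∧
      IsCompl (sigma K U).toSubmodule (iota K U').toSubmodule := by
  refine ⟨(isSemisimpleRepresentation_iff_exists_complement _).mpr fun X hX => ?_, ?_, ?_⟩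
  · obtain ⟨C, hC, -⟩ := h₁ X (hX.trans (sigma_toSubmodule_le K U))
    refine ⟨C ⊓ sigma K U, hC.disjoint.symm.mono_left inf_le_left, ?_⟩
    rw [Subrepresentation.toSubmodule_inf, inf_comm, inf_sup_assoc_of_le _ hX, sup_comm,
      hC.sup_eq_top, inf_top_eq]
  · obtain ⟨W', hW', hle⟩ := h₁ (sigma K U) (sigma_toSubmodule_le K U)
    exact hW'.disjoint.mono_right (iota_toSubmodule_le _ hle)
  · obtain ⟨W', hW', hle⟩ := h₂ (iota K U') (le_iota_toSubmodule K U')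
    exact hW'.codisjoint.symm.mono_left (le_sigma_toSubmodule _ hle)

end Equivalences

end RelativeCR

theorem proposition5p1 {k V : Type*} [Field k] [IsAlgClosed k] [AddCommGroup V] [Module k V]
    [FiniteDimensional k V] (U U' : Submodule k V) (hU : IsCompl U U')
    (K : Subgroup (LinearMap.GeneralLinearGroup k V)) :
    (RelativeCR.IsRelativelyCR K (RelativeCR.glSubgroup hU) ↔
      (∀ W : RelativeCR.KSubmodule K, W.toSubmodule ≤ U →
        ∃ W' : RelativeCR.KSubmodule K,
          IsCompl W.toSubmodule W'.toSubmodule ∧ U' ≤ W'.toSubmodule) ∧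
      (∀ W : RelativeCR.KSubmodule K, U' ≤ W.toSubmodule →
        ∃ W' : RelativeCR.KSubmodule K,
          IsCompl W.toSubmodule W'.toSubmodule ∧ W'.toSubmodule ≤ U)) ∧
    (RelativeCR.IsRelativelyCR K (RelativeCR.glSubgroup hU) ↔
      (RelativeCR.sigma K U).toRepresentation.IsSemisimpleRepresentation ∧
      IsCompl (RelativeCR.sigma K U).toSubmodule (RelativeCR.iota K U').toSubmodule) := by
  have : Infinite k := inferInstance
  have h₁₂ := fun h : RelativeCR.IsRelativelyCR K (RelativeCR.glSubgroup hU) =>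
    And.intro (h.exists_complement_of_le hU) (h.exists_complement_of_ge hU)
  have h₃₁ := fun h : (RelativeCR.sigma K U).toRepresentation.IsSemisimpleRepresentation ∧
      IsCompl (RelativeCR.sigma K U).toSubmodule (RelativeCR.iota K U').toSubmodule =>
    RelativeCR.isRelativelyCR_of_isCompl hU h.1 h.2
  exact ⟨⟨h₁₂, fun h => h₃₁ (RelativeCR.isSemisimple_and_isCompl_of_complements h.1 h.2)⟩,
    ⟨fun h => RelativeCR.isSemisimple_and_isCompl_of_complements (h₁₂ h).1 (h₁₂ h).2, h₃₁⟩⟩
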